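/- Let $E$ be a finite set of items and $N$ a finite set of buyers. Item $e\in E$ is available in $b(e)\in\mathbb{Z}_{+}$ units, a bundle is a vector $z\in\mathbb{Z}^E$ with $0\le z\le b$, and buyer $i\in N$ has a non-decreasing valuation $v_i$ that assigns to every bundle a value in $\mathbb{Z}_+$. Write $x(S)=\sum_{e\in S}x(e)$ for $S\subseteq E$. For prices $p\in\mathbb{R}^E$ let $\mathcal{D}_i(p)$ be the set of bundles $z$ that maximize $v_i(z)-\sum_{e\in E}p(e)z(e)$, and let $\check{\mathcal D}_i(p)$ and $\hat{\mathcal D}_i(p)$ be the sets of its component-wise minimal and maximal elements. Assume that every $v_i$ is strong gross substitutes, that is, gross substitutes when each copy of each item is treated as an individual item with its own price: with $\tilde E=\{(e,k): e\in E,\ 1\le k\le b(e)\}$ and $\tilde v_i(X)=v_i(z_X)$ for $X\subseteq\tilde E$, where $z_X(e)$ is the number of copies of $e$ in $X$, for all $\tilde p\le\tilde q$ in $\mathbb{R}^{\tilde E}$ and every $X\subseteq \tilde E$ maximizing $\tilde v_i(\cdot)-\tilde p(\cdot)$ there is a $Y\subseteq\tilde E$ maximizing $\tilde v_i(\cdot)-\tilde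 q(\cdot)$ that contains all $c\in X$ with $\tilde p(c)=\tilde q(c)$. Let $p\in\mathbb{R}^E_{+}$. The prices $p$ are called packing (respectively, covering) if there are $z_i\in\mathcal{D}_i(p)$, $i\in N$, with $\sum_{i\in N}z_i(e)\le b(e)$ (respectively, $\ge b(e)$) for all $e\in E$. A set $S\subseteq E$ is called overdemanded if $\sum_{i\in N}\min\{z(S): z\in\check{\mathcal D}_i(p)\}-b(S)>0$, and underdemanded if $b(S)-\sum_{i\in N}\max\{z(S): z\in\hat{\mathcal D}_i(p)\}>0$. Then: (1) $p$ is packing if and only if there is no overdemanded set; (2) $p$ is covering if and only if there is no underdemanded set. -/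

import Mathlib

namespace Auction

/-- The bundles of a market with supply `b`: the integer points of the box `[0, b]`. -/
abbrev Bundle {E : Type*} (b : E → ℕ) : Type _ := {z : E → ℕ // z ≤ b}

/-- `z(S) = ∑_{e ∈ S} z(e)`. -/
def units {E : Type*} (z : E → ℕ) (S : Finset E) : ℕ := ∑ e ∈ S, z e

/-- The utility `v(z) - ⟨p, z⟩`. -/
noncomputable def utility {E : Type*} [Fintype E] {b : E → ℕ} (v : Bundle b → ℕ) (p : E → ℝ)
    (z : Bundle b) : ℝ :=
  (v z : ℝ) - ∑ e, p e * (z.1 e : ℝ)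

/-- The demand set: the bundles maximizing the utility. -/
def demand {E : Type*} [Fintype E] {b : E → ℕ} (v : Bundle b → ℕ) (p : E → ℝ) :
    Set (Bundle b) :=
  {z | ∀ y : Bundle b, utility v p y ≤ utility v p z}

/-- The inclusion-wise minimal preferred bundles. -/
def minDemand {E : Type*} [Fintype E] {b : E → ℕ} (v : Bundle b → ℕ) (p : E → ℝ) :
    Set (Bundle b) :=
  {z | z ∈ demand v p ∧ ¬ ∃ y ∈ demand v p, y ≠ z ∧ y ≤ z}

/-- The inclusion-wise maximal preferred bundles. -/
def maxDemand {E : Type*} [Fintype E] {b : E → ℕ} (v : Bundle b → ℕ) (p : E → ℝ) :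
    Set (Bundle b) :=
  {z | z ∈ demand v p ∧ ¬ ∃ y ∈ demand v p, y ≠ z ∧ z ≤ y}

/-! Gross substitutes valuations -/

/-- The demand set of a set function (one unit of each item) at item prices `p`. -/
def setDemand {E : Type*} (w : Finset E → ℕ) (p : E → ℝ) : Set (Finset E) :=
  {X | ∀ Y : Finset E, (w Y : ℝ) - ∑ e ∈ Y, p e ≤ (w X : ℝ) - ∑ e ∈ X, p e}

/-- Gross substitutes for unit supply: if prices rise from `p` to `q`, then every bundle demanded
at `p` can be replaced by one demanded at `q` that keeps all its items of unchanged price. -/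
def GrossSubstitutes {E : Type*} (w : Finset E → ℕ) : Prop :=
  ∀ p q : E → ℝ, p ≤ q → ∀ X ∈ setDemand w p, ∃ Y ∈ setDemand w q,
    ∀ e, p e = q e → e ∈ X → e ∈ Y

/-- The individual copies of the items: item `e` has `b e` copies. -/
abbrev Copy {E : Type*} (b : E → ℕ) : Type _ := Σ e : E, Fin (b e)

/-- The bundle corresponding to a set of copies: `e ↦` number of copies of `e` in the set. -/
def bundleOf {E : Type*} [DecidableEq E] {b : E → ℕ} (X : Finset (Copy b)) : Bundle b :=
  ⟨fun e => (X.filter fun c => c.1 = e).card, fun e => by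
    have h : (X.filter fun c => c.1 = e) ⊆
        (Finset.univ : Finset (Fin (b e))).map
          ⟨fun k => (⟨e, k⟩ : Copy b), fun _ _ h => by simpa using h⟩ := by
      rintro ⟨f, k⟩ hc
      obtain rfl : f = e := (Finset.mem_filter.mp hc).2
      exact Finset.mem_map.mpr ⟨k, Finset.mem_univ k, rfl⟩
    simpa using Finset.card_le_card h⟩

/-- Strong gross substitutes: gross substitutes when every copy of every item is treated as an
individual item with its own price. -/
def StrongGrossSubstitutes {E : Type*} [DecidableEq E] {b : E → ℕ} (v : Bundle b → ℕ) : Prop :=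
  GrossSubstitutes fun X : Finset (Copy b) => v (bundleOf X)

/-! Packing and covering prices -/

/-- Prices supporting an allocation of preferred bundles in which no item is oversold. -/
def IsPacking {E N : Type*} [Fintype E] [Fintype N] (b : E → ℕ) (v : N → Bundle b → ℕ)
    (p : E → ℝ) : Prop :=
  ∃ z : N → Bundle b, (∀ i, z i ∈ demand (v i) p) ∧ ∀ e, ∑ i, (z i).1 e ≤ b e

/-- Prices supporting an allocation of preferred bundles in which no item is undersold. -/
def IsCovering {E N : Type*} [Fintype E] [Fintype N] (b : E → ℕ) (v : N → Bundle b → ℕ)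
    (p : E → ℝ) : Prop :=
  ∃ z : N → Bundle b, (∀ i, z i ∈ demand (v i) p) ∧ ∀ e, b e ≤ ∑ i, (z i).1 e

/-! Overdemanded and underdemanded sets -/

/-- The least number of units from `S` in a minimal preferred bundle
(a minimum, see `isLeast_minUnits`). -/
noncomputable def minUnits {E : Type*} [Fintype E] {b : E → ℕ} (v : Bundle b → ℕ) (p : E → ℝ)
    (S : Finset E) : ℕ :=
  sInf ((fun z : Bundle b => units z.1 S) '' minDemand v p)

/-- The largest number of units from `S` in a maximal preferred bundle
(a maximum, see `isGreatest_maxUnits`). -/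
noncomputable def maxUnits {E : Type*} [Fintype E] {b : E → ℕ} (v : Bundle b → ℕ) (p : E → ℝ)
    (S : Finset E) : ℕ :=
  sSup ((fun z : Bundle b => units z.1 S) '' maxDemand v p)

/-- Overdemandedness: least demand minus supply. -/
noncomputable def overdemandedness {E N : Type*} [Fintype E] [Fintype N] (b : E → ℕ)
    (v : N → Bundle b → ℕ) (p : E → ℝ) (S : Finset E) : ℤ :=
  ∑ i, (minUnits (v i) p S : ℤ) - (units b S : ℤ)

/-- Underdemandedness: supply minus largest demand. -/
noncomputable def underdemandedness {E N : Type*} [Fintype E] [Fintype N] (b : E → ℕ)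
    (v : N → Bundle b → ℕ) (p : E → ℝ) (S : Finset E) : ℤ :=
  (units b S : ℤ) - ∑ i, (maxUnits (v i) p S : ℤ)

def IsOverdemanded {E N : Type*} [Fintype E] [Fintype N] (b : E → ℕ)
    (v : N → Bundle b → ℕ) (p : E → ℝ) (S : Finset E) : Prop :=
  0 < overdemandedness b v p S

def IsUnderdemanded {E N : Type*} [Fintype E] [Fintype N] (b : E → ℕ)
    (v : N → Bundle b → ℕ) (p : E → ℝ) (S : Finset E) : Prop :=
  0 < underdemandedness b v p S

/-! The minimum and the maximum above are attained. -/

theorem finite_bundle {E : Type*} [Fintype E] (b : E → ℕ) : Finite (Bundle b) := by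
  classical
  exact (Set.finite_Iic b).to_subtype

theorem demand_nonempty {E : Type*} [Fintype E] {b : E → ℕ} (v : Bundle b → ℕ) (p : E → ℝ) :
    (demand v p).Nonempty := by
  have := finite_bundle b
  have : Nonempty (Bundle b) := ⟨⟨0, zero_le⟩⟩
  obtain ⟨z, hz⟩ := Finite.exists_max (utility v p)
  exact ⟨z, hz⟩

theorem minDemand_nonempty {E : Type*} [Fintype E] {b : E → ℕ} (v : Bundle b → ℕ) (p : E → ℝ) :
    (minDemand v p).Nonempty := by
  have := finite_bundle b
  obtain ⟨z, hz⟩ := (Set.toFinite (demand v p)).exists_minimal (demand_nonempty v p)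
  exact ⟨z, hz.1, fun ⟨y, hy, hne, hle⟩ => hne (le_antisymm hle (hz.2 hy hle))⟩

theorem maxDemand_nonempty {E : Type*} [Fintype E] {b : E → ℕ} (v : Bundle b → ℕ) (p : E → ℝ) :
    (maxDemand v p).Nonempty := by
  have := finite_bundle b
  obtain ⟨z, hz⟩ := (Set.toFinite (demand v p)).exists_maximal (demand_nonempty v p)
  exact ⟨z, hz.1, fun ⟨y, hy, hne, hle⟩ => hne (le_antisymm (hz.2 hy hle) hle)⟩

theorem isLeast_minUnits {E : Type*} [Fintype E] {b : E → ℕ} (v : Bundle b → ℕ) (p : E → ℝ)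
    (S : Finset E) :
    IsLeast ((fun z : Bundle b => units z.1 S) '' minDemand v p) (minUnits v p S) :=
  ⟨Nat.sInf_mem ((minDemand_nonempty v p).image _), fun _ h => Nat.sInf_le h⟩

theorem isGreatest_maxUnits {E : Type*} [Fintype E] {b : E → ℕ} (v : Bundle b → ℕ) (p : E → ℝ)
    (S : Finset E) :
    IsGreatest ((fun z : Bundle b => units z.1 S) '' maxDemand v p) (maxUnits v p S) := by
  have := finite_bundle b
  have hb : BddAbove ((fun z : Bundle b => units z.1 S) '' maxDemand v p) :=
    (Set.toFinite _).bddAbove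
  exact ⟨Nat.sSup_mem ((maxDemand_nonempty v p).image _) hb, fun _ h => le_csSup hb h⟩

end Auction

namespace Auction

open Filter Topology Finset

/-! Give every buyer a private set of copies of all items. The sum of the valuations is then one
gross substitutes valuation on `N × Copy b`; its preferred sets at prices `p` are the families of
preferred bundles, and the supply becomes a bound on the number of elements of each type `e`. One
direction of each equivalence is summation over buyers. The other is `GrossSubstitutes.packing` or
`GrossSubstitutes.covering`, for a single valuation on typed elements.

For packing, consider an ascending auction with increments so small that every set demanded in it is
still preferred at `p`. Price levels are capped at `Fintype.card E + 1`, and a state with maximal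
prices, then maximal sales, is examined. If its preferred set `D` oversells a type, that type has
reached the cap. By pigeonhole some positive level `θ` up to the cap is the price of no type; let
`S` be the types above it. Every type in `S` is sold out and `D` contains a further element of `S`,
so `D` exceeds the bound on `S`. Moreover `D` is cheapest for the price increments among the sets
preferred at `p`. The single improvement property turns this into a statement on cardinalities
(`GrossSubstitutes.card_filter_le`): no preferred set has fewer elements above `θ`. So all of them
exceed the bound on `S`.

Covering is packing for the complementary valuation `X ↦ w Xᶜ` at prices `-p`, which is again gross
substitutes. -/

/-- The utility of a set of items at item prices `p`. -/
noncomputable def setUtility {C : Type*} (w : Finset C → ℕ) (p : C → ℝ) (X : Finset C) : ℝ :=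
  (w X : ℝ) - ∑ c ∈ X, p c

/-! ### Demand sets and small price perturbations. -/

section SetDemand

variable {C : Type*} {w : Finset C → ℕ}

theorem mem_setDemand {p : C → ℝ} {X : Finset C} :
    X ∈ setDemand w p ↔ ∀ Y, setUtility w p Y ≤ setUtility w p X := Iff.rfl

theorem setUtility_add (w : Finset C → ℕ) (p r : C → ℝ) (X : Finset C) :
    setUtility w (p + r) X = setUtility w p X - ∑ c ∈ X, r c := by
  simp only [setUtility, Pi.add_apply, sum_add_distrib]; ring

theorem setDemand_nonempty [Fintype C] (w : Finset C → ℕ) (p : C → ℝ) : (setDemand w p).Nonempty :=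
  Finite.exists_max (setUtility w p)

theorem setUtility_eq_of_mem {p : C → ℝ} {X Y : Finset C} (hX : X ∈ setDemand w p)
    (hY : Y ∈ setDemand w p) : setUtility w p X = setUtility w p Y :=
  le_antisymm (hY X) (hX Y)

theorem mem_setDemand_of_le {p : C → ℝ} {X Y : Finset C} (hX : X ∈ setDemand w p)
    (h : setUtility w p X ≤ setUtility w p Y) : Y ∈ setDemand w p :=
  fun Z => (hX Z).trans h

/-- Nearly optimal sets are optimal. -/
theorem exists_gap [Fintype C] (w : Finset C → ℕ) (p : C → ℝ) :
    ∃ δ > 0, ∀ X ∈ setDemand w p, ∀ W, setUtility w p X - δ < setUtility w p W →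
      W ∈ setDemand w p := by
  obtain ⟨X₀, hX₀⟩ := setDemand_nonempty w p
  have key : ∀ᶠ δ : ℝ in 𝓝[>] 0, ∀ W, setUtility w p X₀ - δ < setUtility w p W →
      W ∈ setDemand w p := by
    refine eventually_all.2 fun W => ?_
    by_cases hW : W ∈ setDemand w p
    · exact Eventually.of_forall fun _ _ => hW
    · have hlt : 0 < setUtility w p X₀ - setUtility w p W := by
        by_contra hle
        exact hW (mem_setDemand_of_le hX₀ (by linarith))
      filter_upwards [Ioo_mem_nhdsGT hlt] with δ hδ h
      linarith [hδ.2]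
  obtain ⟨δ, hδ, hpos⟩ := (key.and self_mem_nhdsWithin).exists
  exact ⟨δ, hpos, fun X hX W h => hδ W (by rwa [setUtility_eq_of_mem hX₀ hX])⟩

theorem abs_sum_le_mul_card [Fintype C] {r : C → ℝ} {B : ℝ} (hr : ∀ c, |r c| ≤ B) (X : Finset C) :
    |∑ c ∈ X, r c| ≤ B * Fintype.card C := by
  calc |∑ c ∈ X, r c| ≤ ∑ c ∈ X, |r c| := abs_sum_le_sum_abs _ _
    _ ≤ ∑ c, |r c| := sum_le_sum_of_subset_of_nonneg (subset_univ _) fun _ _ _ => abs_nonneg _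
    _ ≤ ∑ _c : C, B := sum_le_sum fun c _ => hr c
    _ = B * Fintype.card C := by simp [mul_comm]

/-- Small price changes only shrink the demand set. -/
theorem exists_perturbation [Fintype C] (w : Finset C → ℕ) (p : C → ℝ) {B : ℝ} (hB : 0 ≤ B) :
    ∃ ε : ℝ, 0 < ε ∧ ∀ r : C → ℝ, (∀ c, |r c| ≤ B) →
      setDemand w (p + ε • r) ⊆ setDemand w p := by
  obtain ⟨δ, hδ, h⟩ := exists_gap w p
  obtain ⟨X, hX⟩ := setDemand_nonempty w p
  set K : ℝ := B * Fintype.card C with hKdef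
  have hK : 0 ≤ K := by positivity
  refine ⟨δ / (2 * K + 1), by positivity, fun r hr W hW => h X hX W ?_⟩
  have h1 := hW X
  change setUtility w _ X ≤ setUtility w _ W at h1
  simp only [setUtility_add, Pi.smul_apply, smul_eq_mul, ← mul_sum] at h1
  set ε := δ / (2 * K + 1)
  have hε : 0 < ε := by positivity
  have hεK : ε * (2 * K + 1) = δ := div_mul_cancel₀ _ (by positivity)
  have hX' := (abs_le.1 (abs_sum_le_mul_card hr X)).2
  have hW' := (abs_le.1 (abs_sum_le_mul_card hr W)).1
  rw [← hKdef] at hX' hW'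
  have := mul_le_mul_of_nonneg_left hX' hε.le
  have := mul_le_mul_of_nonneg_left hW' hε.le
  linarith

theorem sum_le_sum_of_mem_perturbed {p r : C → ℝ} {ε : ℝ} (hε : 0 < ε) {W Z : Finset C}
    (hW : W ∈ setDemand w (p + ε • r)) (hZ : Z ∈ setDemand w p) :
    ∑ c ∈ W, r c ≤ ∑ c ∈ Z, r c := by
  have h1 := hW Z
  have h2 := hZ W
  change setUtility w _ Z ≤ setUtility w _ W at h1
  change setUtility w _ W ≤ setUtility w _ Z at h2
  simp only [setUtility_add, Pi.smul_apply, smul_eq_mul, ← mul_sum] at h1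
  exact le_of_mul_le_mul_left (by linarith) hε

/-! ### Exchange properties of gross substitutes. -/

/-- If exactly two sets are preferred, they differ by a single exchange. -/
theorem GrossSubstitutes.card_sdiff_le_one [DecidableEq C] (hw : GrossSubstitutes w) {q : C → ℝ}
    {X Z : Finset C} (hX : X ∈ setDemand w q) (hZ : Z ∈ setDemand w q)
    (h : ∀ W ∈ setDemand w q, W = X ∨ W = Z) : #(Z \ X) ≤ 1 := by
  rw [card_le_one]
  intro c hc d hd
  by_contra hcd
  rw [Finset.mem_sdiff] at hc hd
  have hsum : ∀ W : Finset C, ∑ a ∈ W, (Pi.single c 1 : C → ℝ) a = if c ∈ W then 1 else 0 :=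
    fun W => by simp [Pi.single_apply]
  -- Raising the price of `c` alone leaves `X` as the only preferred set, yet gross substitutes
  -- keeps `d`.
  obtain ⟨W, hW, hWZ⟩ := hw q (q + Pi.single c 1)
    (le_add_of_nonneg_right (Pi.single_nonneg.2 zero_le_one)) Z hZ
  have hWX := hW X
  change setUtility w _ X ≤ setUtility w _ W at hWX
  rw [setUtility_add, setUtility_add, hsum, hsum, if_neg hc.2] at hWX
  have hXW := hX W
  change setUtility w _ W ≤ setUtility w _ X at hXW
  have hcW : c ∉ W := fun hcW => by
    rw [if_pos hcW] at hWX
    linarith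
  rw [if_neg hcW] at hWX
  rcases h W (mem_setDemand_of_le hX (by linarith)) with rfl | rfl
  · exact hd.2 (hWZ d (by simp [Ne.symm hcd]) hd.1)
  · exact hcW hc.1

/-- A preferred set that is not the only one has a preferred neighbour which differs from it by a
single exchange. -/
theorem GrossSubstitutes.exists_adjacent [Fintype C] [DecidableEq C] (hw : GrossSubstitutes w)
    {q : C → ℝ} {X Y : Finset C} (hX : X ∈ setDemand w q) (hY : Y ∈ setDemand w q) (hne : Y ≠ X) :
    ∃ Z ∈ setDemand w q, Z ≠ X ∧ #(Z \ X) ≤ 1 ∧ #(X \ Z) ≤ 1 := by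
  classical
  obtain ⟨Z, hZ, hmin⟩ := exists_min_image
    (univ.filter fun Z => Z ∈ setDemand w q ∧ Z ≠ X) (fun Z => #(symmDiff Z X))
    ⟨Y, by simp [hY, hne]⟩
  simp only [mem_filter, mem_univ, true_and, and_imp] at hZ hmin
  obtain ⟨hZ, hZX⟩ := hZ
  obtain ⟨ε, hε, hpert⟩ := exists_perturbation w q (B := 1) zero_le_one
  -- Penalizing elements outside `X ∪ Z` and rewarding those in `X ∩ Z` leaves only sets between the
  -- two; as `Z` is nearest to `X`, only `X` and `Z` themselves survive.
  let r : C → ℝ := fun c => (if c ∉ X ∪ Z then 1 else 0) - (if c ∈ X ∩ Z then 1 else 0)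
  have hr : ∀ c, |r c| ≤ 1 := fun c => by
    simp only [r, mem_union, mem_inter]
    by_cases h1 : c ∈ X <;> by_cases h2 : c ∈ Z <;> simp [h1, h2]
  have hsum : ∀ W, ∑ c ∈ W, r c = (#(W \ (X ∪ Z)) : ℝ) - #(W ∩ (X ∩ Z)) := fun W => by
    simp only [r, sum_sub_distrib, sum_boole, filter_notMem_eq_sdiff, filter_mem_eq_inter]
  have hrX : ∑ c ∈ X, r c = -#(X ∩ Z) := by
    rw [hsum, sdiff_eq_empty_iff_subset.2 subset_union_left,
      inter_eq_right.2 inter_subset_left]; simp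
  have hrZ : ∑ c ∈ Z, r c = -#(X ∩ Z) := by
    rw [hsum, sdiff_eq_empty_iff_subset.2 subset_union_right,
      inter_eq_right.2 inter_subset_right]; simp
  have htwo : ∀ W ∈ setDemand w (q + ε • r), W = X ∨ W = Z := by
    intro W hW
    have h1 := sum_le_sum_of_mem_perturbed hε hW hX
    rw [hrX, hsum] at h1
    have h2 : #(W \ (X ∪ Z)) + #(X ∩ Z) ≤ #(W ∩ (X ∩ Z)) := by
      have : (#(W \ (X ∪ Z)) : ℝ) + #(X ∩ Z) ≤ #(W ∩ (X ∩ Z)) := by linarith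
      exact_mod_cast this
    have h3 : #(W ∩ (X ∩ Z)) ≤ #(X ∩ Z) := card_le_card inter_subset_right
    have h4 : W ⊆ X ∪ Z := sdiff_eq_empty_iff_subset.1 (card_eq_zero.1 (by omega))
    have h5 : X ∩ Z ⊆ W :=
      inter_eq_right.1 (eq_of_subset_of_card_le inter_subset_right (by omega))
    refine or_iff_not_imp_left.2 fun hWX => ?_
    have h6 : symmDiff W X ⊆ symmDiff Z X := by
      intro c
      have h4' := @h4 c
      have h5' := @h5 c
      simp only [mem_union, mem_inter] at h4' h5'
      simp only [mem_symmDiff]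
      tauto
    exact symmDiff_left_injective X
      (eq_of_subset_of_card_le h6 (hmin W (hpert r hr hW) hWX))
  have heq : setUtility w (q + ε • r) X = setUtility w (q + ε • r) Z := by
    simp only [setUtility_add, Pi.smul_apply, smul_eq_mul, ← mul_sum, hrX, hrZ,
      setUtility_eq_of_mem hX hZ]
  obtain ⟨W, hW⟩ := setDemand_nonempty w (q + ε • r)
  have hX' : X ∈ setDemand w (q + ε • r) := by
    rcases htwo W hW with rfl | rfl
    · exact hW
    · exact mem_setDemand_of_le hW heq.ge
  have hZ' : Z ∈ setDemand w (q + ε • r) := mem_setDemand_of_le hX' heq.le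
  exact ⟨Z, hZ, hZX, hw.card_sdiff_le_one hX' hZ' htwo,
    hw.card_sdiff_le_one hZ' hX' fun W hW => (htwo W hW).symm⟩

/-- The single improvement property. -/
theorem GrossSubstitutes.exists_improvement [Fintype C] [DecidableEq C] (hw : GrossSubstitutes w)
    {p : C → ℝ} {X Y : Finset C} (h : setUtility w p X < setUtility w p Y) :
    ∃ Z, setUtility w p X < setUtility w p Z ∧ #(Z \ X) ≤ 1 ∧ #(X \ Z) ≤ 1 := by
  have hYX : Y ≠ X := by rintro rfl; exact h.false
  let d : Finset C → ℝ := fun W => #(W \ X) + #(X \ W)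
  have hd : ∀ W, W ≠ X → 0 < d W := by
    intro W hWX
    by_contra hle
    have h1 : #(W \ X) + #(X \ W) ≤ 0 := by
      have : (#(W \ X) : ℝ) + #(X \ W) ≤ 0 := not_lt.1 hle
      exact_mod_cast this
    refine hWX (Subset.antisymm ?_ ?_) <;>
    · rw [← sdiff_eq_empty_iff_subset, ← card_eq_zero]
      omega
  -- `V` has the best gain per unit of distance from `X`. Charging this rate `l` for every change to
  -- `X` makes `X` and `V` tie for optimal, and any set tied with them gains `l` times its distance
  -- at the prices `p`.
  obtain ⟨V, hV, hmax⟩ := exists_max_image (univ.erase X)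
    (fun W => (setUtility w p W - setUtility w p X) / d W) ⟨Y, by simp [hYX]⟩
  simp only [mem_erase, mem_univ, and_true] at hV hmax
  set l := (setUtility w p V - setUtility w p X) / d V with hl
  have hl0 : 0 < l :=
    (div_pos (sub_pos.2 h) (hd Y hYX)).trans_le (hmax Y hYX)
  let r : C → ℝ := fun c => if c ∈ X then -l else l
  have hsum : ∀ W, ∑ c ∈ W, r c = l * d W - l * #X := by
    intro W
    have h1 : (#(W ∩ X) : ℝ) + #(X \ W) = #X := by
      rw [inter_comm]; exact_mod_cast card_inter_add_card_sdiff X W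
    simp only [r, d, sum_ite, sum_const, nsmul_eq_mul, filter_notMem_eq_sdiff,
      filter_mem_eq_inter, ← h1]
    ring
  have hdX : d X = 0 := by simp [d]
  have hX' : X ∈ setDemand w (p + r) := by
    refine mem_setDemand.2 fun W => ?_
    rw [setUtility_add, setUtility_add, hsum, hsum, hdX]
    rcases eq_or_ne W X with rfl | hWX
    · rw [hdX]
    · have := (div_le_iff₀ (hd W hWX)).1 (hmax W hWX)
      linarith
  have hV' : V ∈ setDemand w (p + r) := by
    refine mem_setDemand_of_le hX' ?_
    rw [setUtility_add, setUtility_add, hsum, hsum, hdX]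
    have : l * d V = _ := div_mul_cancel₀ _ (hd V hV).ne'
    linarith
  obtain ⟨Z, hZ, hZX, h1, h2⟩ := hw.exists_adjacent hX' hV' hV
  refine ⟨Z, ?_, h1, h2⟩
  have h3 := setUtility_eq_of_mem hX' hZ
  rw [setUtility_add, setUtility_add, hsum, hsum, hdX] at h3
  have := mul_pos hl0 (hd Z hZX)
  linarith

/-- A cheapest preferred set has the least possible number of elements above any positive
threshold of the costs. -/
theorem GrossSubstitutes.card_filter_le [Fintype C] [DecidableEq C] (hw : GrossSubstitutes w)
    {p : C → ℝ} {D : Finset C} (hD : D ∈ setDemand w p) {π : C → ℕ}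
    (hmin : ∀ Z ∈ setDemand w p, ∑ c ∈ D, π c ≤ ∑ c ∈ Z, π c) {θ : ℕ} (hθ : 0 < θ)
    {Z : Finset C} (hZ : Z ∈ setDemand w p) :
    #(D.filter fun c => θ ≤ π c) ≤ #(Z.filter fun c => θ ≤ π c) := by
  by_contra! hlt
  obtain ⟨δ, hδ, hgap⟩ := exists_gap w p
  -- A small tax on the elements above the threshold makes `Z` better than `D`, so a single exchange
  -- improves `D`. It stays preferred at `p`, gives up an element costing at least `θ` and gains at
  -- most one, costing at most `θ - 1`: cheaper than `D`.
  let r : C → ℝ := fun c => if θ ≤ π c then 1 else 0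
  have hsum : ∀ W : Finset C, ∑ c ∈ W, r c = #(W.filter fun c => θ ≤ π c) := fun W => by
    simp only [r, sum_boole]
  obtain ⟨ε, hε, hεδ⟩ : ∃ ε > 0, ε * (#(D.filter fun c => θ ≤ π c) : ℝ) < δ := by
    refine ⟨δ / (#(D.filter fun c => θ ≤ π c) + 1), by positivity, ?_⟩
    rw [div_mul_eq_mul_div, div_lt_iff₀ (by positivity)]
    linarith
  have hu : ∀ W, setUtility w (p + ε • r) W =
      setUtility w p W - ε * #(W.filter fun c => θ ≤ π c) := fun W => by
    simp only [setUtility_add, Pi.smul_apply, smul_eq_mul, ← mul_sum, hsum]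
  have hDZ : setUtility w (p + ε • r) D < setUtility w (p + ε • r) Z := by
    rw [hu, hu, setUtility_eq_of_mem hD hZ]
    have := mul_lt_mul_of_pos_left (Nat.cast_lt (α := ℝ).2 hlt) hε
    linarith
  obtain ⟨Y, hY, h1, h2⟩ := hw.exists_improvement hDZ
  rw [hu, hu] at hY
  have hYD : Y ∈ setDemand w p := by
    refine hgap D hD Y ?_
    have : 0 ≤ ε * (#(Y.filter fun c => θ ≤ π c) : ℝ) := by positivity
    linarith
  have hlt' : #(Y.filter fun c => θ ≤ π c) < #(D.filter fun c => θ ≤ π c) := by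
    rw [setUtility_eq_of_mem hYD hD] at hY
    have := lt_of_mul_lt_mul_left (sub_lt_sub_iff_left _ |>.1 hY) hε.le
    exact_mod_cast this
  have hle := hmin Y hYD
  have hcard := card_sdiff_lt_card_sdiff_iff.2 hlt'
  obtain ⟨a, ha⟩ := card_pos.1 (Nat.zero_lt_of_lt hcard)
  have hsub : D.filter (θ ≤ π ·) \ Y.filter (θ ≤ π ·) ⊆ D \ Y := by
    intro c; simp only [Finset.mem_sdiff, mem_filter]; tauto
  have hempty : Y.filter (θ ≤ π ·) \ D.filter (θ ≤ π ·) = ∅ := by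
    have := card_le_card hsub
    exact card_eq_zero.1 (by omega)
  have hlow : ∀ c ∈ Y \ D, π c ≤ θ - 1 := by
    intro c hc
    rw [Finset.mem_sdiff] at hc
    by_contra hcθ
    have : c ∈ Y.filter (θ ≤ π ·) \ D.filter (θ ≤ π ·) := by
      simp only [Finset.mem_sdiff, mem_filter]
      exact ⟨⟨hc.1, by omega⟩, fun h => hc.2 h.1⟩
    simp [hempty] at this
  have hYsum : ∑ c ∈ Y \ D, π c ≤ θ - 1 :=
    (sum_le_card_nsmul _ _ _ hlow).trans (by simpa using Nat.mul_le_mul_right (θ - 1) h1)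
  have hDsum : θ ≤ ∑ c ∈ D \ Y, π c := by
    have h3 : θ ≤ π a := (mem_filter.1 (Finset.mem_sdiff.1 ha).1).2
    exact h3.trans (single_le_sum (f := π) (fun _ _ => Nat.zero_le _) (hsub ha))
  have h3 := sum_inter_add_sum_sdiff Y D π
  have h4 := sum_inter_add_sum_sdiff D Y π
  rw [inter_comm] at h4
  omega

/-! ### The ascending auction. -/

/-- A state of the ascending auction at base prices `p` with increment `ε`: the price of an item of
type `e` has been raised `q e` times, the items of `H` are provisionally sold, possibly at the
previous price, and the sold items are part of a preferred set at the current prices `p + ε π`. -/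
structure AuctionState [DecidableEq C] {E : Type*} [DecidableEq E] (w : Finset C → ℕ) (p : C → ℝ)
    (ε : ℝ) (ty : C → E) (s : E → ℕ) (h : ℕ) (q : E → ℕ) (π : C → ℕ) (H : Finset C) : Prop where
  le_cap : ∀ e, q e ≤ h
  le_price : ∀ c, π c ≤ q (ty c)
  price_le : ∀ c, q (ty c) ≤ π c + 1
  price_eq : ∀ c, c ∉ H → π c = q (ty c)
  demanded : ∃ D ∈ setDemand w (p + ε • fun c => (π c : ℝ)), H ⊆ D
  card_le : ∀ e, #(H.filter (ty · = e)) ≤ s e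
  card_eq : ∀ e, 0 < q e → #(H.filter (ty · = e)) = s e

theorem filter_insert_card [DecidableEq C] {P : C → Prop} [DecidablePred P] {H : Finset C} {c : C}
    (hc : c ∉ H) : #((insert c H).filter P) = #(H.filter P) + if P c then 1 else 0 := by
  rw [filter_insert]
  split_ifs
  · rw [card_insert_of_notMem (by simp [hc])]
  · rfl

theorem card_filter_mem {E : Type*} [DecidableEq E] (ty : C → E) (S : Finset E) (Z : Finset C) :
    #(Z.filter (ty · ∈ S)) = ∑ e ∈ S, #(Z.filter (ty · = e)) := by
  rw [card_eq_sum_card_fiberwise (f := ty) (t := S) (s := Z.filter (ty · ∈ S))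
    (fun a ha => by simpa using (mem_filter.1 ha).2)]
  refine sum_congr rfl fun e he => ?_
  rw [filter_filter]
  congr 1
  exact filter_congr fun a _ => ⟨And.right, fun ha => ⟨ha ▸ he, ha⟩⟩

theorem filter_erase_card [DecidableEq C] {P : C → Prop} [DecidablePred P] {H : Finset C} {c : C}
    (hc : c ∈ H) : #((H.erase c).filter P) + (if P c then 1 else 0) = #(H.filter P) := by
  conv_rhs => rw [← insert_erase hc, filter_insert_card (notMem_erase c H)]

/-- Raising prices keeps the demanded items of unchanged price. -/
theorem GrossSubstitutes.exists_demand_of_le (hw : GrossSubstitutes w) {p : C → ℝ} {ε : ℝ}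
    (hε : 0 < ε) {π π' : C → ℕ} (hle : π ≤ π') {D K : Finset C}
    (hD : D ∈ setDemand w (p + ε • fun c => (π c : ℝ))) (hKD : K ⊆ D)
    (heq : ∀ c ∈ K, π c = π' c) :
    ∃ D' ∈ setDemand w (p + ε • fun c => (π' c : ℝ)), K ⊆ D' := by
  have hmono : (p + ε • fun c => (π c : ℝ)) ≤ p + ε • fun c => (π' c : ℝ) := by
    intro c
    have : (π c : ℝ) ≤ π' c := Nat.cast_le.2 (hle c)
    simpa using mul_le_mul_of_nonneg_left this hε.le
  obtain ⟨D', hD', h⟩ := hw _ _ hmono D hD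
  exact ⟨D', hD', fun c hc => h c (by simp [heq c hc]) (hKD hc)⟩

/-- If the number of available items of each type is bounded by `s`, then either some preferred
set respects these bounds, or some set of types is overdemanded by all the preferred sets. -/
theorem GrossSubstitutes.packing [Fintype C] [DecidableEq C] {E : Type*} [Fintype E]
    [DecidableEq E] (hw : GrossSubstitutes w) (p : C → ℝ) (ty : C → E) (s : E → ℕ) :
    (∃ D ∈ setDemand w p, ∀ e, #(D.filter (ty · = e)) ≤ s e) ∨
      ∃ S : Finset E, ∀ Z ∈ setDemand w p, ∑ e ∈ S, s e < #(Z.filter (ty · ∈ S)) := by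
  set h : ℕ := Fintype.card E + 1 with hh
  set k : ℕ := Fintype.card C
  obtain ⟨ε, hε, hpert⟩ := exists_perturbation w p (B := h) (Nat.cast_nonneg _)
  -- The weight `k + 1` exceeds every `#H`, so `Φ` compares prices first and sales second.
  let Φ : (C → ℕ) → Finset C → ℕ := fun π H => (∑ c, π c) * (k + 1) + #H
  have hbdd : BddAbove {n | ∃ q π H, AuctionState w p ε ty s h q π H ∧ Φ π H = n} := by
    refine ⟨(k * h) * (k + 1) + k, ?_⟩
    rintro _ ⟨q, π, H, hst, rfl⟩
    refine Nat.add_le_add (Nat.mul_le_mul_right _ ?_) (card_le_univ H)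
    calc ∑ c, π c ≤ ∑ _c : C, h := sum_le_sum fun c _ => (hst.le_price c).trans (hst.le_cap _)
      _ = k * h := by simp [k]
  obtain ⟨D₀, hD₀⟩ := setDemand_nonempty w (p + ε • fun _ => ((0 : ℕ) : ℝ))
  have hne : {n | ∃ q π H, AuctionState w p ε ty s h q π H ∧ Φ π H = n}.Nonempty :=
    ⟨_, 0, 0, ∅, ⟨by simp, by simp, by simp, by simp, ⟨D₀, hD₀, by simp⟩, by simp, by simp⟩, rfl⟩
  obtain ⟨q, π, H, hst, hΦ⟩ := Nat.sSup_mem hne hbdd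
  have hmax : ∀ q' π' H', AuctionState w p ε ty s h q' π' H' → Φ π' H' ≤ Φ π H := by
    intro q' π' H' hst'
    rw [hΦ]
    exact le_csSup hbdd ⟨q', π', H', hst', rfl⟩
  have hmax' : ∀ q' π' H', AuctionState w p ε ty s h q' π' H' → ∑ c, π' c ≤ ∑ c, π c := by
    intro q' π' H' hst'
    have h1 := hmax q' π' H' hst'
    simp only [Φ] at h1
    by_contra! hlt
    have h2 : (∑ c, π c + 1) * (k + 1) ≤ (∑ c, π' c) * (k + 1) := Nat.mul_le_mul_right _ hlt
    have h3 : #H ≤ k := card_le_univ H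
    rw [add_mul] at h2
    omega
  obtain ⟨D, hD, hHD⟩ := hst.demanded
  have hDp : D ∈ setDemand w p := hpert _ (fun c => by
    rw [Nat.abs_cast]
    exact Nat.cast_le.2 ((hst.le_price c).trans (hst.le_cap _))) hD
  by_cases hpack : ∀ e, #(D.filter (ty · = e)) ≤ s e
  · exact Or.inl ⟨D, hDp, hpack⟩
  refine Or.inr ?_
  obtain ⟨e, he⟩ := not_forall.1 hpack
  obtain ⟨c, hcD, hcH, hce⟩ : ∃ c ∈ D, c ∉ H ∧ ty c = e := by
    by_contra! hall
    refine he ((card_le_card fun c hc => ?_).trans (hst.card_le e))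
    rw [mem_filter] at hc ⊢
    exact ⟨by_contra fun hcH => hall c hc.1 hcH hc.2, hc.2⟩
  have hfull : #(H.filter (ty · = e)) = s e := by
    refine le_antisymm (hst.card_le e) (not_lt.1 fun hlt => ?_)
    have h1 : AuctionState w p ε ty s h q π (insert c H) := by
      refine ⟨hst.le_cap, hst.le_price, hst.price_le,
        fun d hd => hst.price_eq d fun hdH => hd (mem_insert_of_mem hdH),
        ⟨D, hD, insert_subset hcD hHD⟩, fun f => ?_, fun f hf => ?_⟩
      · rw [filter_insert_card hcH, hce]
        split_ifs with hef
        · subst hef; omega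
        · exact hst.card_le f
      · have hef : ty c ≠ f := by
          rintro rfl
          have := hst.card_eq _ hf
          rw [hce] at this
          omega
        rw [filter_insert_card hcH, if_neg hef]
        exact hst.card_eq f hf
    have := hmax _ _ _ h1
    simp only [Φ, card_insert_of_notMem hcH] at this
    omega
  have hcurrent : ∀ d ∈ H, ty d = e → π d = q e := by
    intro d hd hde
    by_contra hne
    have hlt : π d < q e := lt_of_le_of_ne (hde ▸ hst.le_price d) hne
    have hdc : d ≠ c := by rintro rfl; exact hcH hd
    have hle : π ≤ Function.update π d (q e) := by
      rw [le_update_iff]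
      exact ⟨hlt.le, fun _ _ => le_rfl⟩
    -- Here `c` takes over the sale from `d`, whose price then rises to the current one. Only an
    -- unsold price moves, so the sold items remain jointly demanded.
    have h1 : AuctionState w p ε ty s h q (Function.update π d (q e))
        ((insert c H).erase d) := by
      refine ⟨hst.le_cap, fun a => ?_, fun a => ?_, fun a ha => ?_, ?_, fun f => ?_, fun f hf => ?_⟩
      · rcases eq_or_ne a d with rfl | had
        · simp [hde]
        · simpa [had] using hst.le_price a
      · exact (hst.price_le a).trans (Nat.add_le_add_right (hle a) 1)
      · rcases eq_or_ne a d with rfl | had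
        · simp [hde]
        · rw [Function.update_of_ne had]
          exact hst.price_eq a fun haH => ha (mem_erase.2 ⟨had, mem_insert_of_mem haH⟩)
      · refine hw.exists_demand_of_le hε hle hD
          ((erase_subset _ _).trans (insert_subset hcD hHD)) fun a ha => ?_
        rw [Function.update_of_ne (ne_of_mem_erase ha)]
      all_goals
        have h2 := filter_erase_card (P := (ty · = f)) (mem_insert_of_mem hd : d ∈ insert c H)
        rw [filter_insert_card hcH, hde, hce] at h2
      · have := hst.card_le f
        omega
      · have := hst.card_eq f hf
        omega
    have h2 := hmax' _ _ _ h1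
    have h3 := sum_lt_sum (s := univ) (fun a _ => hle a) ⟨d, mem_univ d, by simpa using hlt⟩
    omega
  have hcap : q e = h := by
    refine le_antisymm (hst.le_cap e) (not_lt.1 fun hlt => ?_)
    -- Below the cap the price of `e` could rise: sold elements keep what is now the previous price,
    -- unsold ones pay the new one.
    let π' : C → ℕ := fun a => if ty a = e ∧ a ∉ H then q e + 1 else π a
    have hle : π ≤ π' := by
      intro a
      simp only [π']
      split_ifs with ha
      · have := hst.le_price a
        rw [ha.1] at this
        omega
      · exact le_rfl
    have h1 : AuctionState w p ε ty s h (Function.update q e (q e + 1)) π' H := by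
      refine ⟨fun f => ?_, fun a => ?_, fun a => ?_, fun a ha => ?_, ?_, hst.card_le, fun f hf => ?_⟩
      · rcases eq_or_ne f e with rfl | hfe
        · simpa using hlt
        · simpa [hfe] using hst.le_cap f
      · have := hst.le_price a
        by_cases hae : ty a = e
        · by_cases haH : a ∈ H
          · simp [π', hae, haH]; rw [hae] at this; omega
          · simp [π', hae, haH]
        · simpa [π', hae] using this
      · have := hst.price_le a
        by_cases hae : ty a = e
        · by_cases haH : a ∈ H
          · simp [π', hae, haH, hcurrent a haH hae]
          · simp [π', hae, haH]
        · simpa [π', hae] using this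
      · by_cases hae : ty a = e
        · simp [π', hae, ha]
        · simpa [π', hae] using hst.price_eq a ha
      · exact hw.exists_demand_of_le hε hle hD hHD fun a ha => by simp [π', ha]
      · rcases eq_or_ne f e with rfl | hfe
        · exact hfull
        · exact hst.card_eq f (by simpa [hfe] using hf)
    have h2 := hmax' _ _ _ h1
    have h3 : π c < π' c := by
      have := hst.price_eq c hcH
      rw [hce] at this
      simp [π', hce, hcH, this]
    have h4 := sum_lt_sum (s := univ) (fun a _ => hle a) ⟨c, mem_univ c, h3⟩
    omega
  -- There is one more level than there are types.
  obtain ⟨θ, hθ, hθq⟩ : ∃ θ ∈ Finset.Icc 1 h, ∀ f, q f ≠ θ := by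
    by_contra! hall
    have h1 : Finset.Icc 1 h ⊆ univ.image q := fun θ hθ => by simpa using hall θ hθ
    have h2 := (card_le_card h1).trans card_image_le
    simp [hh] at h2
  rw [Finset.mem_Icc] at hθ
  refine ⟨univ.filter (θ ≤ q ·), fun Z hZ => ?_⟩
  -- Each `π a` is `q (ty a)` or one less, and `q` skips `θ`, so both lie on the same side of the
  -- threshold.
  have hlevel : ∀ W : Finset C, W.filter (ty · ∈ univ.filter (θ ≤ q ·)) = W.filter (θ ≤ π ·) := by
    intro W
    refine filter_congr fun a _ => ?_
    have h1 := hst.le_price a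
    have h2 := hst.price_le a
    have h3 := hθq (ty a)
    simp only [mem_filter, mem_univ, true_and]
    omega
  have hmin := hw.card_filter_le hDp (π := π) (fun Z hZ => by
    exact_mod_cast sum_le_sum_of_mem_perturbed hε hD hZ) hθ.1 hZ
  rw [hlevel]
  refine lt_of_lt_of_le ?_ hmin
  rw [← hlevel]
  calc ∑ f ∈ univ.filter (θ ≤ q ·), s f
      = ∑ f ∈ univ.filter (θ ≤ q ·), #(H.filter (ty · = f)) := sum_congr rfl fun f hf =>
        (hst.card_eq f (lt_of_lt_of_le hθ.1 (mem_filter.1 hf).2)).symm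
    _ = #(H.filter (ty · ∈ univ.filter (θ ≤ q ·))) := (card_filter_mem _ _ _).symm
    _ < #(D.filter (ty · ∈ univ.filter (θ ≤ q ·))) := by
        refine card_lt_card (ssubset_iff_of_subset (filter_subset_filter _ hHD) |>.2
          ⟨c, mem_filter.2 ⟨hcD, ?_⟩, fun hc => hcH (mem_filter.1 hc).1⟩)
        simp [hce, hcap, hθ.2]

/-! ### Complementation and covering. -/

theorem compl_mem_setDemand [Fintype C] [DecidableEq C] {p : C → ℝ} {X : Finset C} :
    X ∈ setDemand (fun X => w Xᶜ) p ↔ Xᶜ ∈ setDemand w (-p) := by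
  have h : ∀ W, setUtility (fun X => w Xᶜ) p W = setUtility w (-p) Wᶜ - ∑ c, p c := fun W => by
    have := sum_add_sum_compl W p
    simp only [setUtility, Pi.neg_apply, sum_neg_distrib]
    linarith
  simp only [mem_setDemand, h, sub_le_sub_iff_right]
  exact ⟨fun hX Y => by simpa using hX Yᶜ, fun hX Y => hX Yᶜ⟩

/-- The gross substitutes property is inherited by the complementary valuation. -/
theorem GrossSubstitutes.compl [Fintype C] [DecidableEq C] (hw : GrossSubstitutes w) :
    GrossSubstitutes fun X => w Xᶜ := by
  intro p q hpq X hX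
  rw [compl_mem_setDemand] at hX
  obtain ⟨ε, hε, hpert⟩ := exists_perturbation w (-q) (B := 1) zero_le_one
  -- Among all sets `Xᶜ` alone minimizes `r`, so the demand at `-p + ε • r` is forced to avoid `X`.
  -- An element of `W ∩ X` of unchanged price would survive into it.
  let r : C → ℝ := fun c => if c ∈ X then 1 else -1
  have hr : ∀ c, |r c| ≤ 1 := fun c => by simp only [r]; split_ifs <;> simp
  obtain ⟨W, hW⟩ := setDemand_nonempty w (-q + ε • r)
  refine ⟨Wᶜ, by rw [compl_mem_setDemand, compl_compl]; exact hpert r hr hW, fun c hc hcX => ?_⟩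
  obtain ⟨Y, hY, hWY⟩ := hw (-q + ε • r) (-p + ε • r) (by gcongr) W hW
  have hYX := sum_le_sum_of_mem_perturbed hε hY hX
  have hsum : ∀ V, ∑ a ∈ V, r a = (#(V ∩ X) : ℝ) - #(V \ X) := fun V => by
    simp only [r, sum_ite, sum_const, nsmul_eq_mul, filter_notMem_eq_sdiff, filter_mem_eq_inter]
    ring
  have hXX : Xᶜ ∩ X = ∅ := disjoint_iff_inter_eq_empty.1 disjoint_compl_left
  have hXX' : Xᶜ \ X = Xᶜ := sdiff_eq_self_of_disjoint disjoint_compl_left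
  rw [hsum, hsum, hXX, hXX'] at hYX
  have hle : #(Y ∩ X) + #Xᶜ ≤ #(Y \ X) := by
    have : (#(Y ∩ X) : ℝ) + #Xᶜ ≤ #(Y \ X) := by
      rw [card_empty] at hYX; push_cast at hYX; linarith
    exact_mod_cast this
  have hsub : #(Y \ X) ≤ #Xᶜ := card_le_card fun a ha => by simp [(Finset.mem_sdiff.1 ha).2]
  have hdisj : Y ∩ X = ∅ := card_eq_zero.1 (by omega)
  rw [mem_compl]
  intro hcW
  have : c ∈ Y ∩ X := mem_inter.2 ⟨hWY c (by simp [hc]) hcW, hcX⟩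
  simp [hdisj] at this

/-- Either some preferred set contains at least `s e` items of each type `e`, or some set of types
is underdemanded by all the preferred sets. -/
theorem GrossSubstitutes.covering [Fintype C] [DecidableEq C] {E : Type*} [Fintype E]
    [DecidableEq E] (hw : GrossSubstitutes w) (p : C → ℝ) (ty : C → E) (s : E → ℕ) :
    (∃ D ∈ setDemand w p, ∀ e, s e ≤ #(D.filter (ty · = e))) ∨
      ∃ S : Finset E, ∀ Z ∈ setDemand w p, #(Z.filter (ty · ∈ S)) < ∑ e ∈ S, s e := by
  -- This keeps the truncated subtraction in the complementary bounds exact.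
  by_cases hs : ∀ e, s e ≤ #(univ.filter (ty · = e))
  swap
  · obtain ⟨e, he⟩ := not_forall.1 hs
    refine Or.inr ⟨{e}, fun Z _ => ?_⟩
    simp only [mem_singleton, sum_singleton]
    exact (card_le_card (filter_subset_filter _ (subset_univ Z))).trans_lt (not_le.1 he)
  have hcompl : ∀ (P : C → Prop) [DecidablePred P] (Z : Finset C),
      #(Z.filter P) + #(Zᶜ.filter P) = #(univ.filter P) := fun P _ Z => by
    rw [← card_union_of_disjoint (disjoint_filter_filter disjoint_compl_right), ← filter_union,
      union_compl]
  rcases hw.compl.packing (-p) ty (fun e => #(univ.filter (ty · = e)) - s e) with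
    ⟨D, hD, hle⟩ | ⟨S, hS⟩
  · refine Or.inl ⟨Dᶜ, by simpa using compl_mem_setDemand.1 hD, fun e => ?_⟩
    have := hcompl (ty · = e) D
    have := hle e
    have := hs e
    omega
  · refine Or.inr ⟨S, fun Z hZ => ?_⟩
    have h1 := hS Zᶜ (compl_mem_setDemand.2 (by simpa using hZ))
    have h2 := hcompl (ty · ∈ S) Z
    have h3 : ∑ e ∈ S, (#(univ.filter (ty · = e)) - s e) + ∑ e ∈ S, s e =
        #(univ.filter (ty · ∈ S)) := by
      rw [← sum_add_distrib, card_filter_mem]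
      exact sum_congr rfl fun e _ => Nat.sub_add_cancel (hs e)
    omega

end SetDemand

/-! ### Merging the buyers into one valuation. -/

section Aggregate

variable {N C : Type*} [Fintype N] [Fintype C] [DecidableEq N] [DecidableEq C]

/-- The items that buyer `i` receives when each buyer has a private copy of the items. -/
def slice (X : Finset (N × C)) (i : N) : Finset C := univ.filter fun c => (i, c) ∈ X

theorem exists_slice_eq (Y : N → Finset C) : ∃ X : Finset (N × C), slice X = Y :=
  ⟨univ.filter fun x => x.2 ∈ Y x.1, by ext i c; simp [slice]⟩

theorem sum_eq_sum_slice {M : Type*} [AddCommMonoid M] (X : Finset (N × C)) (f : N × C → M) :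
    ∑ x ∈ X, f x = ∑ i, ∑ c ∈ slice X i, f (i, c) := by
  simp only [slice, sum_filter]
  rw [← Fintype.sum_prod_type' (f := fun i c => if (i, c) ∈ X then f (i, c) else 0),
    ← sum_filter]
  simp

theorem card_filter_eq_sum_slice (X : Finset (N × C)) (P : C → Prop) [DecidablePred P] :
    #(X.filter fun x => P x.2) = ∑ i, #((slice X i).filter P) := by
  simp only [card_filter]
  exact sum_eq_sum_slice X fun x => if P x.2 then 1 else 0

/-- The aggregate valuation of all the buyers. -/
def aggregate (w : N → Finset C → ℕ) (X : Finset (N × C)) : ℕ := ∑ i, w i (slice X i)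

theorem setUtility_aggregate (w : N → Finset C → ℕ) (p : N × C → ℝ) (X : Finset (N × C)) :
    setUtility (aggregate w) p X = ∑ i, setUtility (w i) (fun c => p (i, c)) (slice X i) := by
  simp only [setUtility, aggregate, sum_sub_distrib, Nat.cast_sum, sum_eq_sum_slice X p]

theorem mem_setDemand_aggregate {w : N → Finset C → ℕ} {p : N × C → ℝ} {X : Finset (N × C)} :
    X ∈ setDemand (aggregate w) p ↔ ∀ i, slice X i ∈ setDemand (w i) fun c => p (i, c) := by
  simp only [mem_setDemand, setUtility_aggregate]
  refine ⟨fun h i Y => ?_, fun h Y => sum_le_sum fun i _ => h i _⟩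
  obtain ⟨Z, hZ⟩ := exists_slice_eq (Function.update (slice X) i Y)
  by_contra! hlt
  refine (h Z).not_gt (sum_lt_sum (fun j _ => ?_) ⟨i, mem_univ i, by simpa [hZ] using hlt⟩)
  rw [hZ]
  rcases eq_or_ne j i with rfl | hj
  · simpa using hlt.le
  · simp [hj]

/-- The aggregate demand is a product over the buyers, so replacements can be chosen buyer by buyer.
-/
theorem GrossSubstitutes.aggregate {w : N → Finset C → ℕ} (hw : ∀ i, GrossSubstitutes (w i)) :
    GrossSubstitutes (aggregate w) := by
  intro p q hpq X hX
  rw [mem_setDemand_aggregate] at hX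
  choose Y hY hXY using fun i =>
    hw i (fun c => p (i, c)) (fun c => q (i, c)) (fun c => hpq _) (slice X i) (hX i)
  obtain ⟨Z, rfl⟩ := exists_slice_eq Y
  refine ⟨Z, mem_setDemand_aggregate.2 hY, fun ⟨i, c⟩ hc hcX => ?_⟩
  simpa [slice] using hXY i c hc (by simpa [slice] using hcX)

end Aggregate

theorem units_bundleOf {E : Type*} [DecidableEq E] {b : E → ℕ} (X : Finset (Copy b)) (S : Finset E) :
    units (bundleOf X).1 S = #(X.filter (·.1 ∈ S)) :=
  (card_filter_mem _ S X).symm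

/-! ### From sets of copies back to bundles. -/

section Bundles

variable {E : Type*} [Fintype E] {b : E → ℕ} {v : Bundle b → ℕ} {p : E → ℝ}

/-- Every preferred bundle dominates a minimal one. -/
theorem minUnits_le {z : Bundle b} (hz : z ∈ demand v p) (S : Finset E) :
    minUnits v p S ≤ units z.1 S := by
  have := finite_bundle b
  obtain ⟨y, hyz, hy⟩ := (Set.toFinite (demand v p)).exists_le_minimal hz
  exact ((isLeast_minUnits v p S).2 ⟨y, ⟨hy.1, fun ⟨x, hx, hne, hle⟩ =>
    hne (le_antisymm hle (hy.2 hx hle))⟩, rfl⟩).trans (sum_le_sum fun e _ => hyz e)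

theorem le_maxUnits {z : Bundle b} (hz : z ∈ demand v p) (S : Finset E) :
    units z.1 S ≤ maxUnits v p S := by
  have := finite_bundle b
  obtain ⟨y, hzy, hy⟩ := (Set.toFinite (demand v p)).exists_le_maximal hz
  exact (sum_le_sum fun e _ => hzy e).trans ((isGreatest_maxUnits v p S).2
    ⟨y, ⟨hy.1, fun ⟨x, hx, hne, hle⟩ => hne (le_antisymm (hy.2 hx hle) hle)⟩, rfl⟩)

variable [DecidableEq E]

theorem bundleOf_surjective : Function.Surjective (bundleOf : Finset (Copy b) → Bundle b) := by
  intro z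
  refine ⟨univ.filter fun c => c.2.1 < z.1 c.1, Subtype.ext (funext fun e => ?_)⟩
  have h : ((univ.filter fun c : Copy b => c.2.1 < z.1 c.1).filter fun c => c.1 = e) =
      (univ.filter fun k : Fin (b e) => k.1 < z.1 e).map ⟨Sigma.mk e, sigma_mk_injective⟩ := by
    ext ⟨f, k⟩
    simp only [mem_filter, mem_univ, true_and, Finset.mem_map, Function.Embedding.coeFn_mk]
    constructor
    · rintro ⟨hk, rfl⟩
      exact ⟨k, hk, rfl⟩
    · rintro ⟨l, hl, heq⟩
      obtain ⟨rfl, h⟩ := Sigma.mk.inj heq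
      obtain rfl := eq_of_heq h
      exact ⟨hl, rfl⟩
  change #_ = _
  rw [h, card_map, Fin.card_filter_val_lt, min_eq_right (z.2 e)]

/-- All copies of an item have the same price, so only their number matters. -/
theorem setUtility_bundleOf (v : Bundle b → ℕ) (p : E → ℝ) (X : Finset (Copy b)) :
    setUtility (fun X => v (bundleOf X)) (fun c => p c.1) X = utility v p (bundleOf X) := by
  simp only [setUtility, utility, bundleOf]
  congr 1
  rw [← sum_fiberwise X (fun c => c.1)]
  refine sum_congr rfl fun e _ => ?_
  rw [sum_congr rfl fun c hc => congrArg p (mem_filter.1 hc).2, sum_const, nsmul_eq_mul, mul_comm]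

theorem mem_setDemand_bundleOf {X : Finset (Copy b)} :
    X ∈ setDemand (fun X => v (bundleOf X)) (fun c => p c.1) ↔ bundleOf X ∈ demand v p := by
  simp only [mem_setDemand, setUtility_bundleOf]
  exact (bundleOf_surjective.forall (p := fun y => utility v p y ≤ utility v p (bundleOf X))).symm

variable {N : Type*} [Fintype N] [DecidableEq N] {u : N → Bundle b → ℕ}

/-- The aggregate valuation of the copies of the items, one set of copies for each buyer. -/
def copyValuation (u : N → Bundle b → ℕ) : Finset (N × Copy b) → ℕ :=
  aggregate fun i X => u i (bundleOf X)

theorem mem_setDemand_copyValuation {X : Finset (N × Copy b)} :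
    X ∈ setDemand (copyValuation u) (fun x => p x.2.1) ↔
      ∀ i, bundleOf (slice X i) ∈ demand (u i) p :=
  mem_setDemand_aggregate.trans (forall_congr' fun _ => mem_setDemand_bundleOf)

theorem exists_bundleOf_slice_eq (z : N → Bundle b) :
    ∃ X : Finset (N × Copy b), ∀ i, bundleOf (slice X i) = z i := by
  choose Y hY using fun i => bundleOf_surjective (z i)
  obtain ⟨X, rfl⟩ := exists_slice_eq Y
  exact ⟨X, hY⟩

theorem card_filter_eq_sum_bundleOf (X : Finset (N × Copy b)) (e : E) :
    #(X.filter (·.2.1 = e)) = ∑ i, (bundleOf (slice X i)).1 e :=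
  card_filter_eq_sum_slice X (·.1 = e)

theorem card_filter_eq_sum_units (X : Finset (N × Copy b)) (S : Finset E) :
    #(X.filter (·.2.1 ∈ S)) = ∑ i, units (bundleOf (slice X i)).1 S := by
  simp only [units_bundleOf]
  exact card_filter_eq_sum_slice X (·.1 ∈ S)

/-! ### The two equivalences. -/

theorem isPacking_iff (hu : ∀ i, StrongGrossSubstitutes (u i)) :
    IsPacking b u p ↔ ¬ ∃ S : Finset E, IsOverdemanded b u p S := by
  constructor
  · rintro ⟨z, hz, hle⟩ ⟨S, hS⟩
    have h1 : ∑ i, minUnits (u i) p S ≤ units b S := calc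
      _ ≤ ∑ i, units (z i).1 S := sum_le_sum fun i _ => minUnits_le (hz i) S
      _ = ∑ e ∈ S, ∑ i, (z i).1 e := sum_comm
      _ ≤ units b S := sum_le_sum fun e _ => hle e
    have h2 : (0 : ℤ) < ∑ i, (minUnits (u i) p S : ℤ) - units b S := hS
    rw [← Nat.cast_sum] at h2
    omega
  · intro h
    rcases (GrossSubstitutes.aggregate hu).packing (fun x => p x.2.1) (fun x => x.2.1) b with
      ⟨D, hD, hle⟩ | ⟨S, hS⟩
    · refine ⟨fun i => bundleOf (slice D i), mem_setDemand_copyValuation.1 hD, fun e => ?_⟩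
      rw [← card_filter_eq_sum_bundleOf]
      exact hle e
    · refine (h ⟨S, ?_⟩).elim
      -- The violated bound holds for every family of preferred bundles, hence for the one attaining
      -- each buyer's minimum on `S`.
      choose z hz hzS using fun i => (isLeast_minUnits (u i) p S).1
      obtain ⟨X, hX⟩ := exists_bundleOf_slice_eq z
      have h1 := hS X (mem_setDemand_copyValuation.2 fun i => by rw [hX]; exact (hz i).1)
      rw [card_filter_eq_sum_units] at h1
      simp only [hX, hzS] at h1
      change (0 : ℤ) < ∑ i, (minUnits (u i) p S : ℤ) - units b S
      rw [← Nat.cast_sum, sub_pos]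
      exact Nat.cast_lt.2 h1

theorem isCovering_iff (hu : ∀ i, StrongGrossSubstitutes (u i)) :
    IsCovering b u p ↔ ¬ ∃ S : Finset E, IsUnderdemanded b u p S := by
  constructor
  · rintro ⟨z, hz, hle⟩ ⟨S, hS⟩
    have h1 : units b S ≤ ∑ i, maxUnits (u i) p S := calc
      _ ≤ ∑ e ∈ S, ∑ i, (z i).1 e := sum_le_sum fun e _ => hle e
      _ = ∑ i, units (z i).1 S := sum_comm
      _ ≤ _ := sum_le_sum fun i _ => le_maxUnits (hz i) S
    have h2 : (0 : ℤ) < units b S - ∑ i, (maxUnits (u i) p S : ℤ) := hS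
    rw [← Nat.cast_sum] at h2
    omega
  · intro h
    rcases (GrossSubstitutes.aggregate hu).covering (fun x => p x.2.1) (fun x => x.2.1) b with
      ⟨D, hD, hle⟩ | ⟨S, hS⟩
    · refine ⟨fun i => bundleOf (slice D i), mem_setDemand_copyValuation.1 hD, fun e => ?_⟩
      rw [← card_filter_eq_sum_bundleOf]
      exact hle e
    · refine (h ⟨S, ?_⟩).elim
      choose z hz hzS using fun i => (isGreatest_maxUnits (u i) p S).1
      obtain ⟨X, hX⟩ := exists_bundleOf_slice_eq z
      have h1 := hS X (mem_setDemand_copyValuation.2 fun i => by rw [hX]; exact (hz i).1)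
      rw [card_filter_eq_sum_units] at h1
      simp only [hX, hzS] at h1
      change (0 : ℤ) < units b S - ∑ i, (maxUnits (u i) p S : ℤ)
      rw [← Nat.cast_sum, sub_pos]
      exact Nat.cast_lt.2 h1

end Bundles

end Auction

theorem mainTheorem8 {E N : Type*} [Fintype E] [DecidableEq E] [Fintype N]
    (b : E → ℕ) (v : N → Auction.Bundle b → ℕ)
    (hmono : ∀ i, Monotone (v i))
    (hsgs : ∀ i, Auction.StrongGrossSubstitutes (v i))
    (p : E → ℝ) (hp : ∀ e, 0 ≤ p e) :
    (Auction.IsPacking b v p ↔ ¬ ∃ S : Finset E, Auction.IsOverdemanded b v p S) ∧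
    (Auction.IsCovering b v p ↔ ¬ ∃ S : Finset E, Auction.IsUnderdemanded b v p S) := by
  classical
  exact ⟨Auction.isPacking_iff hsgs, Auction.isCovering_iff hsgs⟩
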